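/- Let $X=(X_n)_{n\ge 0}$ be a real second order stationary process with covariance sequence $\sigma_X(h)=\mathrm{Cov}(X_n,X_{n+h})=\int_{-\pi}^{\pi}e^{ih\lambda}f_X(\lambda)\,d\lambda$ and spectral density $$f_X(\lambda)=|\Phi(\lambda)|^2\,\Big|\prod_{j=1}^{M}g_j(\lambda)\Big|^2,\qquad g_j(\lambda)=\begin{cases}(e^{i\lambda}-e^{i\theta_j})^{-d_j}(e^{i\lambda}-e^{-i\theta_j})^{-d_j}&\text{if } e^{i\theta_j}\ne e^{-i\theta_j},\\ (e^{i\lambda}-e^{i\theta_j})^{-d_j}&\text{if } e^{i\theta_j}=e^{-i\theta_j},\end{cases}$$ where $M\ge 1$, $d_j\in\,]0,1/2[$, the frequencies $\theta_j\in\mathbb R$ have pairwise distinct cosines (the sets $\{e^{i\theta_j},e^{-i\theta_j}\}$ are pairwise disjoint), and $|\Phi|^2$ is the spectral density of an ARMA process, that is, $|\Phi(\lambda)|^2=\frac{s}{2\pi}\,|B(e^{i\lambda})|^2/|A(e^{i\lambda})|^2$ with $s>0$ and real polynomials $A,B$, where $B\neq0$ and $A$ has no zero on the unit circle. Put $d=\max_j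 d_j$. Let $T_0=0$ and $T_n=\Delta_1+\dots+\Delta_n$, where $(\Delta_j)_{j\ge1}$ are independent random variables with values in $\{1,2,\dots\}$ and common law $S$, and suppose that the random walk $(T_n)_{n\ge0}$ is independent of the process $X$. Assume that, for some $c>0$ and $\gamma>1$, $$S(j)=P(T_1=j)\sim c\,j^{-\gamma}\qquad(j\to\infty).$$ If $1<\gamma<2(1-d)$, then the sampled process $Y_n=X_{T_n}$ has short memory: $Y$ is second order stationary, and its covariance sequence $\sigma_Y(h)=\mathrm{Cov}(Y_n,Y_{n+h})$ satisfies $\sum_{h\ge0}|\sigma_Y(h)|<\infty$. -/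

import Mathlib

open MeasureTheory ProbabilityTheory Filter Asymptotics
open scoped Topology Polynomial

noncomputable section

namespace RandomSampling

variable {Ω : Type*} [MeasurableSpace Ω]

/-- A real second order (weakly) stationary process indexed by `ℕ`: square-integrable variables,
constant mean, and covariances that depend on the lag only. -/
structure IsSecondOrderStationary (X : ℕ → Ω → ℝ) (P : Measure Ω) : Prop where
  measurable : ∀ n, Measurable (X n)
  memLp : ∀ n, MemLp (X n) 2 P
  mean_eq : ∀ n, ∫ ω, X n ω ∂P = ∫ ω, X 0 ω ∂P
  cov_eq : ∀ n h, covariance (X n) (X (n + h)) P = covariance (X 0) (X h) P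

/-- The covariance sequence `σ_X(h) = Cov(X_0, X_h)`, for `h ≥ 0`. -/
def autocov (X : ℕ → Ω → ℝ) (P : Measure Ω) (h : ℕ) : ℝ :=
  covariance (X 0) (X h) P

/-- Short memory: a second order stationary process whose covariance sequence is absolutely
summable. (Long memory means that `∑ |σ_X(h)| = ∞`.) -/
def HasShortMemory (X : ℕ → Ω → ℝ) (P : Measure Ω) : Prop :=
  IsSecondOrderStationary X P ∧ Summable fun h => |autocov X P h|

/-- `f` is a spectral density of `X`: it is nonnegative, integrable on `[-π, π]`, and
`σ_X(h) = ∫_{-π}^{π} e^{i h t} f(t) dt` for every `h`. (For negative lags the identity follows by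
conjugation, `σ_X` being real and even.) -/
structure HasSpectralDensity (X : ℕ → Ω → ℝ) (P : Measure Ω) (f : ℝ → ℝ) : Prop where
  nonneg : ∀ t, 0 ≤ f t
  integrable : IntervalIntegrable f volume (-Real.pi) Real.pi
  autocov_eq : ∀ h : ℕ, (autocov X P h : ℂ) =
    ∫ t in (-Real.pi)..Real.pi, Complex.exp (Complex.I * h * t) * (f t : ℂ)

/-- `g` is the spectral density `(s / 2π) |B(e^{it})|² / |A(e^{it})|²` of a stationary ARMA process
`A(L) Z = B(L) ε` with real coefficients and noise variance `s > 0`; the autoregressive polynomial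
has no zero on the unit circle. -/
def IsARMASpectralDensity (g : ℝ → ℝ) : Prop :=
  ∃ (A B : ℝ[X]) (s : ℝ), 0 < s ∧ B ≠ 0 ∧
    (∀ z : ℂ, ‖z‖ = 1 → Polynomial.aeval z A ≠ 0) ∧
    ∀ t : ℝ, g t = s / (2 * Real.pi) *
      (‖Polynomial.aeval (Complex.exp (Complex.I * t)) B‖ ^ 2 /
        ‖Polynomial.aeval (Complex.exp (Complex.I * t)) A‖ ^ 2)

/-- The factor of the frequencies `±θ` with exponent `d`, at the point `z` of the unit circle: one
factor `(z - ζ)^{-d}` for each of the points `ζ = e^{iθ}`, `ζ = e^{-iθ}`, which are a single point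
when `sin θ = 0`. -/
def seasonalFactor (θ d : ℝ) (z : ℂ) : ℂ :=
  if Real.sin θ = 0 then
    (z - Complex.exp (Complex.I * θ)) ^ (-(d : ℂ))
  else
    (z - Complex.exp (Complex.I * θ)) ^ (-(d : ℂ)) *
      (z - Complex.exp (-(Complex.I * θ))) ^ (-(d : ℂ))

/-- The spectral density of a generalised fractional process. -/
def genFractionalDensity {M : ℕ} (Φ : ℝ → ℂ) (θ d : Fin M → ℝ) (t : ℝ) : ℝ :=
  ‖Φ t‖ ^ 2 * ‖∏ j, seasonalFactor (θ j) (d j) (Complex.exp (Complex.I * t))‖ ^ 2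

/-- The random walk `T_n = Δ_1 + ⋯ + Δ_n`, `T_0 = 0` (the steps are numbered from `0` here). -/
def randomWalk (Δ : ℕ → Ω → ℕ) (n : ℕ) (ω : Ω) : ℕ :=
  ∑ j ∈ Finset.range n, Δ j ω

/-- `Δ` is a sequence of sampling intervals with law `S`: independent, identically distributed,
with values in the positive integers. -/
structure IsSamplingSteps (Δ : ℕ → Ω → ℕ) (S : PMF ℕ) (P : Measure Ω) : Prop where
  measurable : ∀ j, Measurable (Δ j)
  indep : iIndepFun Δ P
  law : ∀ j, P.map (Δ j) = S.toMeasure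
  law_zero : S 0 = 0

/-- The sampled process `Y_n = X_{T_n}`. -/
def sampledProcess (X : ℕ → Ω → ℝ) (T : ℕ → Ω → ℕ) (n : ℕ) (ω : Ω) : ℝ :=
  X (T n ω) ω

end RandomSampling

end

/-! Conditioning on the walk gives `σ_Y(h) = E[σ_X(T_h)]`, so summability follows from two
estimates: a decay rate for `σ_X` and a lower bound for the growth of `T_h`.

Decay (`exists_abs_autocov_le`): `|σ_X(k)| ≤ C k^{-β}` for every `0 < β < 1 - 2d`. Shifting the
Fourier integral by half a period of `e^{iht}` replaces `f` by `f(t) - f(t + π/h)`, so it suffices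
that `|f s - f t| ≤ |s - t|^β (K s + K t)` with `K` integrable and periodic. For `E^{-2d}` with `E`
Lipschitz, `K` is a multiple of `E^{-(2d+β)}`, integrable near a simple zero because `2d + β < 1`.
Different frequencies have disjoint zeros, and a partition of unity separates them
(`hasHolderGradient_genFractionalDensity`).

Growth (`IsSamplingSteps.measureReal_randomWalk_le`): `T_h ≤ n` forces all `h` steps to be at most
`n`, so `P(T_h ≤ n) ≤ exp(-h P(T_1 > n))`, where `P(T_1 > n) ≥ a n^{1-γ}`. With `n ≈ h^ρ` this
yields, up to constants, `|σ_Y(h)| ≤ exp(-b h^{1-ρ(γ-1)}) + h^{-ρβ}`, summable when `1/β < ρ <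
1/(γ-1)`. Such `β` and `ρ` exist because `γ - 1 < 1 - 2d`. -/

namespace RandomSampling

/-! ### Bounded Hölder functions -/

/-- Bounded functions that are globally Hölder continuous of exponent `β`. -/
def IsBddHolder {E : Type*} [SeminormedAddCommGroup E] (β : ℝ) (f : ℝ → E) : Prop :=
  ∃ C : ℝ, 0 ≤ C ∧ (∀ t, ‖f t‖ ≤ C) ∧ ∀ s t, ‖f s - f t‖ ≤ C * |s - t| ^ β

namespace IsBddHolder

theorem const {E : Type*} [SeminormedAddCommGroup E] (β : ℝ) (c : E) :
    IsBddHolder β fun _ : ℝ => c :=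
  ⟨‖c‖, norm_nonneg c, fun _ => le_rfl, fun s t => by simp only [sub_self, norm_zero]; positivity⟩

theorem add {E : Type*} [SeminormedAddCommGroup E] {β : ℝ} {f g : ℝ → E}
    (hf : IsBddHolder β f) (hg : IsBddHolder β g) : IsBddHolder β fun t => f t + g t := by
  obtain ⟨C, hC, hfC, hfH⟩ := hf
  obtain ⟨D, hD, hgD, hgH⟩ := hg
  refine ⟨C + D, by positivity, fun t => (norm_add_le _ _).trans (add_le_add (hfC t) (hgD t)),
    fun s t => ?_⟩
  calc ‖f s + g s - (f t + g t)‖ = ‖(f s - f t) + (g s - g t)‖ := by congr 1; abel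
    _ ≤ ‖f s - f t‖ + ‖g s - g t‖ := norm_add_le _ _
    _ ≤ C * |s - t| ^ β + D * |s - t| ^ β := add_le_add (hfH s t) (hgH s t)
    _ = _ := by ring

theorem mul {E : Type*} [SeminormedRing E] {β : ℝ} {f g : ℝ → E}
    (hf : IsBddHolder β f) (hg : IsBddHolder β g) : IsBddHolder β fun t => f t * g t := by
  obtain ⟨C, hC, hfC, hfH⟩ := hf
  obtain ⟨D, hD, hgD, hgH⟩ := hg
  refine ⟨2 * (C * D), by positivity, fun t => ?_, fun s t => ?_⟩
  · calc ‖f t * g t‖ ≤ ‖f t‖ * ‖g t‖ := norm_mul_le _ _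
      _ ≤ C * D := mul_le_mul (hfC t) (hgD t) (norm_nonneg _) hC
      _ ≤ 2 * (C * D) := by nlinarith [mul_nonneg hC hD]
  · calc ‖f s * g s - f t * g t‖ = ‖(f s - f t) * g s + f t * (g s - g t)‖ := by
          congr 1; noncomm_ring
      _ ≤ ‖f s - f t‖ * ‖g s‖ + ‖f t‖ * ‖g s - g t‖ :=
          (norm_add_le _ _).trans (add_le_add (norm_mul_le _ _) (norm_mul_le _ _))
      _ ≤ (C * |s - t| ^ β) * D + C * (D * |s - t| ^ β) := by
          gcongr
          exacts [hfH s t, hgD s, hfC t, hgH s t]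
      _ = _ := by ring

theorem sum {E ι : Type*} [SeminormedAddCommGroup E] {β : ℝ} (s : Finset ι) {f : ι → ℝ → E}
    (hf : ∀ i ∈ s, IsBddHolder β (f i)) : IsBddHolder β fun t => ∑ i ∈ s, f i t := by
  classical
  induction s using Finset.induction_on with
  | empty => simpa using const β (0 : E)
  | insert i s hi ih =>
    simp only [Finset.sum_insert hi]
    exact (hf i (Finset.mem_insert_self i s)).add
      (ih fun j hj => hf j (Finset.mem_insert_of_mem hj))

theorem prod {E ι : Type*} [SeminormedCommRing E] {β : ℝ} (s : Finset ι) {f : ι → ℝ → E}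
    (hf : ∀ i ∈ s, IsBddHolder β (f i)) : IsBddHolder β fun t => ∏ i ∈ s, f i t := by
  classical
  induction s using Finset.induction_on with
  | empty => simpa using const β (1 : E)
  | insert i s hi ih =>
    simp only [Finset.prod_insert hi]
    exact (hf i (Finset.mem_insert_self i s)).mul
      (ih fun j hj => hf j (Finset.mem_insert_of_mem hj))

theorem norm {E : Type*} [SeminormedAddCommGroup E] {β : ℝ} {f : ℝ → E}
    (hf : IsBddHolder β f) : IsBddHolder β fun t => ‖f t‖ := by
  obtain ⟨C, hC, hfC, hfH⟩ := hf
  refine ⟨C, hC, fun t => by simpa using hfC t, fun s t => ?_⟩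
  exact (abs_norm_sub_norm_le _ _).trans (hfH s t)

theorem inv {𝕜 : Type*} [NormedField 𝕜] {β m : ℝ} {f : ℝ → 𝕜} (hf : IsBddHolder β f)
    (hm : 0 < m) (hfm : ∀ t, m ≤ ‖f t‖) : IsBddHolder β fun t => (f t)⁻¹ := by
  obtain ⟨C, hC, hfC, hfH⟩ := hf
  have h0 : ∀ t, f t ≠ 0 := fun t => norm_pos_iff.1 (hm.trans_le (hfm t))
  refine ⟨m⁻¹ + C / (m * m), by positivity, fun t => ?_, fun s t => ?_⟩
  · rw [norm_inv]
    exact (inv_anti₀ hm (hfm t)).trans (le_add_of_nonneg_right (by positivity))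
  · rw [inv_sub_inv (h0 s) (h0 t), norm_div, norm_mul, norm_sub_rev]
    calc ‖f s - f t‖ / (‖f s‖ * ‖f t‖) ≤ (C * |s - t| ^ β) / (m * m) := by
          gcongr
          exacts [hfH s t, hfm s, hfm t]
      _ = C / (m * m) * |s - t| ^ β := by ring
      _ ≤ (m⁻¹ + C / (m * m)) * |s - t| ^ β := by
          gcongr
          exact le_add_of_nonneg_left (by positivity)

theorem mono {E : Type*} [SeminormedAddCommGroup E] {β r : ℝ} {f : ℝ → E}
    (hf : IsBddHolder r f) (hβ : 0 ≤ β) (hr : β ≤ r) : IsBddHolder β f := by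
  obtain ⟨C, hC, hfC, hfH⟩ := hf
  refine ⟨2 * C, by positivity, fun t => (hfC t).trans (by linarith), fun s t => ?_⟩
  -- At distance at most `1` a smaller exponent gives a weaker bound; beyond that, boundedness gives
  -- `2 * C`.
  rcases le_total |s - t| 1 with h | h
  · calc ‖f s - f t‖ ≤ C * |s - t| ^ r := hfH s t
      _ ≤ C * |s - t| ^ β := by
          gcongr 1
          rcases (abs_nonneg (s - t)).eq_or_lt with h0 | h0
          · rcases hβ.eq_or_lt with rfl | hβ
            · simpa using Real.rpow_le_one (abs_nonneg _) h hr
            · rw [← h0, Real.zero_rpow hβ.ne', Real.zero_rpow (hβ.trans_le hr).ne']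
          · exact Real.rpow_le_rpow_of_exponent_ge h0 h hr
      _ ≤ 2 * C * |s - t| ^ β := by
          gcongr
          linarith
  · calc ‖f s - f t‖ ≤ ‖f s‖ + ‖f t‖ := norm_sub_le _ _
      _ ≤ C + C := add_le_add (hfC s) (hfC t)
      _ = 2 * C * 1 := by ring
      _ ≤ 2 * C * |s - t| ^ β := by
          gcongr
          exact Real.one_le_rpow h hβ

/-- Subadditivity of `x ↦ x ^ r` for `0 ≤ r ≤ 1` gives `|y ^ r - x ^ r| ≤ |y - x| ^ r`. -/
theorem rpow {r : ℝ} {f : ℝ → ℝ} (hf : IsBddHolder 1 f) (hf0 : ∀ t, 0 ≤ f t)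
    (hr0 : 0 ≤ r) (hr1 : r ≤ 1) : IsBddHolder r fun t => f t ^ r := by
  obtain ⟨C, hC, hfC, hfH⟩ := hf
  refine ⟨C ^ r, by positivity, fun t => ?_, fun s t => ?_⟩
  · rw [Real.norm_of_nonneg (Real.rpow_nonneg (hf0 t) r)]
    exact Real.rpow_le_rpow (hf0 t) ((le_abs_self _).trans (hfC t)) hr0
  · have key : ∀ x y : ℝ, 0 ≤ x → x ≤ y → |y ^ r - x ^ r| ≤ |y - x| ^ r := by
      intro x y hx hxy
      have h := Real.rpow_add_le_add_rpow (sub_nonneg.2 hxy) hx hr0 hr1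
      rw [sub_add_cancel] at h
      rw [abs_of_nonneg (sub_nonneg.2 hxy),
        abs_of_nonneg (sub_nonneg.2 (Real.rpow_le_rpow hx hxy hr0))]
      linarith
    have h : |f s ^ r - f t ^ r| ≤ |f s - f t| ^ r := by
      rcases le_total (f s) (f t) with h | h
      · rw [abs_sub_comm, abs_sub_comm (f s)]
        exact key _ _ (hf0 s) h
      · exact key _ _ (hf0 t) h
    refine h.trans ?_
    rw [← Real.mul_rpow hC (abs_nonneg _)]
    refine Real.rpow_le_rpow (abs_nonneg _) ?_ hr0
    simpa using hfH s t

theorem cexp : IsBddHolder 1 fun t : ℝ => Complex.exp (Complex.I * t) := by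
  refine ⟨1, zero_le_one, fun t => ?_, fun s t => ?_⟩
  · exact (Complex.norm_exp_I_mul_ofReal t).le
  · have h : Complex.exp (Complex.I * s) - Complex.exp (Complex.I * t) =
        Complex.exp (t * Complex.I) * (Complex.exp (Complex.I * ((s - t : ℝ) : ℂ)) - 1) := by
      rw [mul_sub, ← Complex.exp_add, mul_one, mul_comm (t : ℂ)]
      congr 2
      push_cast
      ring
    rw [h, norm_mul, Complex.norm_exp_ofReal_mul_I, one_mul, one_mul, Real.rpow_one]
    exact Real.norm_exp_I_mul_ofReal_sub_one_le

theorem aeval_cexp (p : ℝ[X]) :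
    IsBddHolder 1 fun t : ℝ => Polynomial.aeval (Complex.exp (Complex.I * t)) p := by
  induction p using Polynomial.induction_on' with
  | add p q hp hq => simpa only [map_add] using hp.add hq
  | monomial n a =>
    simp only [Polynomial.aeval_monomial]
    refine (const 1 _).mul ?_
    simpa using prod (Finset.range n) fun _ _ => cexp

end IsBddHolder

theorem exists_pos_le_of_periodic {f : ℝ → ℝ} {c : ℝ} (hc : 0 < c) (hf : Continuous f)
    (hp : Function.Periodic f c) (h0 : ∀ t, 0 < f t) : ∃ m, 0 < m ∧ ∀ t, m ≤ f t := by
  obtain ⟨x, -, hx⟩ := (isCompact_Icc (a := (0 : ℝ)) (b := c)).exists_isMinOn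
    ⟨0, Set.left_mem_Icc.2 hc.le⟩ hf.continuousOn
  refine ⟨f x, h0 x, fun t => ?_⟩
  obtain ⟨y, hy, hty⟩ := hp.exists_mem_Ico₀ hc t
  rw [hty]
  exact hx (Set.Ico_subset_Icc_self hy)

/-! ### Functions with an integrable Hölder gradient -/

/-- Functions `f` with an integrable `2π`-periodic Hölder gradient `K` of exponent `β`:
`|f s - f t| ≤ |s - t| ^ β (K s + K t)`. The majorant also dominates `|f|`. -/
def HasHolderGradient (β : ℝ) (f : ℝ → ℝ) : Prop :=
  ∃ K : ℝ → ℝ, Function.Periodic K (2 * Real.pi) ∧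
    IntervalIntegrable K volume (-Real.pi) Real.pi ∧ (∀ t, |f t| ≤ K t) ∧
    ∀ s t, |f s - f t| ≤ |s - t| ^ β * (K s + K t)

namespace HasHolderGradient

/-- The term `f t * (g s - g t)` is the reason why the majorant has to dominate `|f|` as well as its
increments. -/
theorem mul_isBddHolder {β : ℝ} {f g : ℝ → ℝ} (hf : HasHolderGradient β f)
    (hg : IsBddHolder β g) : HasHolderGradient β fun t => f t * g t := by
  obtain ⟨K, hKp, hKi, hfK, hfH⟩ := hf
  obtain ⟨C, hC, hgC, hgH⟩ := hg
  have hK : ∀ t, 0 ≤ K t := fun t => (abs_nonneg _).trans (hfK t)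
  refine ⟨fun t => 2 * C * K t, fun t => by simp only [hKp t], hKi.const_mul _, fun t => ?_,
    fun s t => ?_⟩
  · rw [abs_mul]
    calc |f t| * |g t| ≤ K t * C := mul_le_mul (hfK t) (hgC t) (abs_nonneg _) (hK t)
      _ ≤ 2 * C * K t := by nlinarith [mul_nonneg hC (hK t)]
  · have e : f s * g s - f t * g t = (f s - f t) * g s + f t * (g s - g t) := by ring
    have hβ : 0 ≤ |s - t| ^ β := by positivity
    calc |f s * g s - f t * g t| ≤ |f s - f t| * |g s| + |f t| * |g s - g t| := by
          rw [e, ← abs_mul, ← abs_mul]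
          exact abs_add_le _ _
      _ ≤ (|s - t| ^ β * (K s + K t)) * C + K t * (C * |s - t| ^ β) := by
          have h1 := hfH s t
          have h2 := hgC s
          have h3 := hgH s t
          have h4 := hK s
          have h5 := hK t
          have h6 := hfK t
          rw [Real.norm_eq_abs] at h2 h3
          gcongr
      _ ≤ |s - t| ^ β * (2 * C * K s + 2 * C * K t) := by
          nlinarith [mul_nonneg hβ (mul_nonneg hC (hK s))]

theorem add {β : ℝ} {f g : ℝ → ℝ} (hf : HasHolderGradient β f)
    (hg : HasHolderGradient β g) : HasHolderGradient β fun t => f t + g t := by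
  obtain ⟨K, hKp, hKi, hfK, hfH⟩ := hf
  obtain ⟨K', hKp', hKi', hfK', hfH'⟩ := hg
  refine ⟨fun t => K t + K' t, hKp.add hKp', hKi.add hKi',
    fun t => (abs_add_le _ _).trans (add_le_add (hfK t) (hfK' t)), fun s t => ?_⟩
  calc |f s + g s - (f t + g t)| = |(f s - f t) + (g s - g t)| := by congr 1; ring
    _ ≤ |f s - f t| + |g s - g t| := abs_add_le _ _
    _ ≤ _ := add_le_add (hfH s t) (hfH' s t)
    _ = _ := by ring

theorem sum {β : ℝ} {ι : Type*} (s : Finset ι) {f : ι → ℝ → ℝ}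
    (hf : ∀ i ∈ s, HasHolderGradient β (f i)) : HasHolderGradient β fun t => ∑ i ∈ s, f i t := by
  classical
  induction s using Finset.induction_on with
  | empty =>
    refine ⟨fun _ => 0, fun _ => rfl, intervalIntegrable_const, ?_, ?_⟩ <;> simp
  | insert i s hi ih =>
    simp only [Finset.sum_insert hi]
    exact (hf i (Finset.mem_insert_self i s)).add
      (ih fun j hj => hf j (Finset.mem_insert_of_mem hj))

end HasHolderGradient

/-- For `0 < x ≤ y`, factor out `x ^ (-a)` and use `1 - (x/y)^a ≤ 1 - x/y ≤ ((y-x)/y)^β ≤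
((y-x)/x)^β`. Since `0` to a nonzero power is `0` here, the case `x = 0 < y` is an equality. -/
theorem abs_rpow_neg_sub_rpow_neg_le {a β x y : ℝ} (ha0 : 0 < a) (ha1 : a ≤ 1) (hβ0 : 0 < β)
    (hβ1 : β ≤ 1) (hx : 0 ≤ x) (hy : 0 ≤ y) :
    |x ^ (-a) - y ^ (-a)| ≤ |x - y| ^ β * (x ^ (-(a + β)) + y ^ (-(a + β))) := by
  wlog hxy : x ≤ y generalizing x y
  · rw [abs_sub_comm, abs_sub_comm x, add_comm (x ^ _)]
    exact this hy hx (le_of_not_ge hxy)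
  rcases hx.eq_or_lt with rfl | hx
  · rcases hy.eq_or_lt with rfl | hy
    · simp only [sub_self, abs_zero]
      positivity
    · rw [Real.zero_rpow (by linarith), Real.zero_rpow (by linarith), zero_sub, zero_sub, abs_neg,
        abs_neg, abs_of_pos hy, abs_of_nonneg (by positivity), zero_add, ← Real.rpow_add hy]
      exact le_of_eq (by congr 1; ring)
  have hy : 0 < y := hx.trans_le hxy
  have hq0 : 0 ≤ (y - x) / y := div_nonneg (sub_nonneg.2 hxy) hy.le
  have hq1 : (y - x) / y ≤ 1 := (div_le_one hy).2 (by linarith)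
  have h1 : y ^ (-a) = x ^ (-a) * (x / y) ^ a := by
    rw [Real.div_rpow hx.le hy.le, Real.rpow_neg hx.le, Real.rpow_neg hy.le]
    field_simp
  have h2 : x / y ≤ (x / y) ^ a := by
    simpa using Real.rpow_le_rpow_of_exponent_ge (div_pos hx hy) ((div_le_one hy).2 hxy) ha1
  have h3 : (y - x) / y ≤ ((y - x) / y) ^ β := by
    rcases hq0.eq_or_lt with h | h
    · rw [← h, Real.zero_rpow hβ0.ne']
    · simpa using Real.rpow_le_rpow_of_exponent_ge h hq1 hβ1
  have h4 : ((y - x) / y) ^ β ≤ ((y - x) / x) ^ β :=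
    Real.rpow_le_rpow hq0 (div_le_div_of_nonneg_left (sub_nonneg.2 hxy) hx hxy) hβ0.le
  have hanti : y ^ (-a) ≤ x ^ (-a) :=
    Real.rpow_le_rpow_of_nonpos hx hxy (by linarith)
  rw [abs_of_nonneg (sub_nonneg.2 hanti), abs_sub_comm, abs_of_nonneg (sub_nonneg.2 hxy)]
  calc x ^ (-a) - y ^ (-a) = x ^ (-a) * (1 - (x / y) ^ a) := by rw [h1]; ring
    _ ≤ x ^ (-a) * ((y - x) / x) ^ β := by
        gcongr
        have : (y - x) / y = 1 - x / y := by field_simp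
        linarith
    _ = (y - x) ^ β * x ^ (-(a + β)) := by
        rw [Real.div_rpow (sub_nonneg.2 hxy) hx.le, neg_add, Real.rpow_add hx,
          Real.rpow_neg hx.le β]
        field_simp
    _ ≤ (y - x) ^ β * (x ^ (-(a + β)) + y ^ (-(a + β))) := by
        gcongr
        exact le_add_of_nonneg_right (by positivity)

/-- A negative power of a Lipschitz function has a Hölder gradient, if a slightly larger negative
power is integrable. -/
theorem hasHolderGradient_rpow_neg {a β : ℝ} (ha0 : 0 < a) (hβ0 : 0 < β) (hab : a + β ≤ 1)
    {u : ℝ → ℝ} (hu : IsBddHolder 1 u) (hu0 : ∀ t, 0 ≤ u t)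
    (hup : Function.Periodic u (2 * Real.pi))
    (hui : IntervalIntegrable (fun t => u t ^ (-(a + β))) volume (-Real.pi) Real.pi) :
    HasHolderGradient β fun t => u t ^ (-a) := by
  obtain ⟨C, hC, huC, huH⟩ := hu
  refine ⟨fun t => (2 * C ^ β) * u t ^ (-(a + β)), fun t => by simp only [hup t],
    hui.const_mul _, fun t => ?_, fun s t => ?_⟩
  · have h0 := hu0 t
    rw [abs_of_nonneg (Real.rpow_nonneg h0 _)]
    have hle : u t ^ β ≤ C ^ β := Real.rpow_le_rpow h0 ((le_abs_self _).trans (huC t)) hβ0.le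
    -- Boundedness of `u` makes the larger negative power dominate. At a zero of `u` both sides are
    -- `0`.
    have e : u t ^ (-a) = u t ^ β * u t ^ (-(a + β)) := by
      rcases h0.eq_or_lt with h | h
      · rw [← h, Real.zero_rpow (by linarith), Real.zero_rpow hβ0.ne', zero_mul]
      · rw [← Real.rpow_add h]
        congr 1
        ring
    rw [e]
    have : 0 ≤ u t ^ (-(a + β)) := Real.rpow_nonneg h0 _
    have hCβ : 0 ≤ C ^ β := by positivity
    exact mul_le_mul_of_nonneg_right (by linarith) this
  · have hs : 0 ≤ u s ^ (-(a + β)) := Real.rpow_nonneg (hu0 s) _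
    have ht : 0 ≤ u t ^ (-(a + β)) := Real.rpow_nonneg (hu0 t) _
    have hCβ : 0 ≤ C ^ β := by positivity
    have hst : |u s - u t| ^ β ≤ C ^ β * |s - t| ^ β := by
      rw [← Real.mul_rpow hC (abs_nonneg _)]
      exact Real.rpow_le_rpow (abs_nonneg _) (by simpa using huH s t) hβ0.le
    calc |u s ^ (-a) - u t ^ (-a)|
        ≤ |u s - u t| ^ β * (u s ^ (-(a + β)) + u t ^ (-(a + β))) :=
          abs_rpow_neg_sub_rpow_neg_le ha0 (by linarith) hβ0 (by linarith) (hu0 s) (hu0 t)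
      _ ≤ (2 * (C ^ β * |s - t| ^ β)) * (u s ^ (-(a + β)) + u t ^ (-(a + β))) := by
          gcongr
          have : 0 ≤ C ^ β * |s - t| ^ β := by positivity
          linarith
      _ = _ := by ring

/-- Fourier coefficients of functions with a Hölder gradient. -/
theorem HasHolderGradient.exists_norm_fourier_le {β : ℝ} {f : ℝ → ℝ}
    (hf : HasHolderGradient β f) (hfp : Function.Periodic f (2 * Real.pi))
    (hfi : IntervalIntegrable f volume (-Real.pi) Real.pi) :
    ∃ C : ℝ, 0 ≤ C ∧ ∀ h : ℕ, 1 ≤ h →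
      ‖∫ t in (-Real.pi)..Real.pi, Complex.exp (Complex.I * h * t) * (f t : ℂ)‖ ≤
        C * (h : ℝ) ^ (-β) := by
  obtain ⟨K, hKp, hKi, hfK, hfH⟩ := hf
  have hK : ∀ t, 0 ≤ K t := fun t => (abs_nonneg _).trans (hfK t)
  have hpi := Real.pi_pos
  have per : ∀ {E : Type} [NormedAddCommGroup E] [NormedSpace ℝ E] (g : ℝ → E),
      Function.Periodic g (2 * Real.pi) → ∀ δ : ℝ,
      ∫ t in (-Real.pi)..Real.pi, g (t + δ) = ∫ t in (-Real.pi)..Real.pi, g t := by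
    intro E _ _ g hg δ
    rw [intervalIntegral.integral_comp_add_right]
    have := hg.intervalIntegral_add_eq (-Real.pi + δ) (-Real.pi)
    rw [show -Real.pi + δ + 2 * Real.pi = Real.pi + δ by ring,
      show -Real.pi + 2 * Real.pi = Real.pi by ring] at this
    exact this
  have hshift : ∀ {g : ℝ → ℝ}, Function.Periodic g (2 * Real.pi) →
      IntervalIntegrable g volume (-Real.pi) Real.pi → ∀ δ,
      IntervalIntegrable (fun t => g (t + δ)) volume (-Real.pi) Real.pi := by
    intro g hg hgi δ
    have := hg.intervalIntegrable (t := -Real.pi) (by positivity)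
      (by rwa [show -Real.pi + 2 * Real.pi = Real.pi by ring]) (-Real.pi + δ) (Real.pi + δ)
    simpa using this.comp_add_right δ
  refine ⟨Real.pi ^ β * ∫ t in (-Real.pi)..Real.pi, K t, ?_, fun h hh => ?_⟩
  · exact mul_nonneg (by positivity)
      (intervalIntegral.integral_nonneg (by linarith) fun t _ => hK t)
  have hh0 : (0 : ℝ) < h := by exact_mod_cast hh
  -- Half a period of `e^{iht}`: translation by `δ` changes the sign of the exponential, so
  -- averaging the integral with its translate leaves only increments of `f` over distance `δ`.
  set δ : ℝ := Real.pi / h with hδ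
  have hδ0 : 0 < δ := by positivity
  set φ : ℝ → ℂ := fun t => Complex.exp (Complex.I * h * t) * (f t : ℂ) with hφ
  have hφp : Function.Periodic φ (2 * Real.pi) := by
    intro t
    simp only [hφ, hfp t]
    congr 1
    rw [Complex.exp_eq_exp_iff_exists_int]
    exact ⟨h, by push_cast; ring⟩
  have hmul : ∀ {g : ℝ → ℝ}, IntervalIntegrable g volume (-Real.pi) Real.pi →
      IntervalIntegrable (fun t : ℝ => Complex.exp (Complex.I * h * t) * (g t : ℂ)) volume
        (-Real.pi) Real.pi := by
    intro g hg
    have hg' : IntervalIntegrable (fun t => (g t : ℂ)) volume (-Real.pi) Real.pi :=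
      ⟨hg.1.ofReal, hg.2.ofReal⟩
    exact hg'.continuousOn_mul (by fun_prop)
  have hφδ : ∀ t, φ (t + δ) = -(Complex.exp (Complex.I * h * t) * (f (t + δ) : ℂ)) := by
    intro t
    have : Complex.I * h * ((t + δ : ℝ) : ℂ) = Complex.I * h * t + Real.pi * Complex.I := by
      have : (h : ℂ) ≠ 0 := by exact_mod_cast hh0.ne'
      rw [hδ]
      push_cast
      field_simp
    simp only [hφ]
    rw [this, Complex.exp_add, Complex.exp_pi_mul_I]
    ring
  have hkey : (2 : ℂ) * ∫ t in (-Real.pi)..Real.pi, φ t =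
      ∫ t in (-Real.pi)..Real.pi, Complex.exp (Complex.I * h * t) * ((f t - f (t + δ) : ℝ) : ℂ) := by
    have h1 := per φ hφp δ
    simp only [hφδ] at h1
    rw [intervalIntegral.integral_neg] at h1
    calc (2 : ℂ) * ∫ t in (-Real.pi)..Real.pi, φ t
        = (∫ t in (-Real.pi)..Real.pi, φ t) - ∫ t in (-Real.pi)..Real.pi,
            Complex.exp (Complex.I * h * t) * (f (t + δ) : ℂ) := by
          linear_combination -h1
      _ = _ := by
          rw [← intervalIntegral.integral_sub (hmul hfi) (hmul (hshift hfp hfi δ))]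
          congr 1
          funext t
          push_cast
          ring
  have hbound : ‖(2 : ℂ) * ∫ t in (-Real.pi)..Real.pi, φ t‖ ≤
      ∫ t in (-Real.pi)..Real.pi, δ ^ β * (K t + K (t + δ)) := by
    rw [hkey]
    refine intervalIntegral.norm_integral_le_of_norm_le (by linarith)
      (ae_of_all _ fun t _ => ?_) ((hKi.add (hshift hKp hKi δ)).const_mul _)
    rw [norm_mul, show Complex.I * h * t = ((h * t : ℝ) : ℂ) * Complex.I by push_cast; ring,
      Complex.norm_exp_ofReal_mul_I, one_mul, Complex.norm_real, Real.norm_eq_abs]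
    simpa [abs_of_pos hδ0] using hfH t (t + δ)
  rw [intervalIntegral.integral_const_mul, intervalIntegral.integral_add hKi (hshift hKp hKi δ),
    per K hKp δ, norm_mul] at hbound
  have hδβ : δ ^ β = Real.pi ^ β * (h : ℝ) ^ (-β) := by
    rw [hδ, Real.div_rpow hpi.le hh0.le, Real.rpow_neg hh0.le]
    rfl
  rw [hδβ] at hbound
  simp only [Complex.norm_ofNat] at hbound
  linarith

/-! ### The spectral density -/

theorem intervalIntegrable_abs_rpow {r : ℝ} (hr : -1 < r) (a : ℝ) (ha : 0 ≤ a) :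
    IntervalIntegrable (fun t : ℝ => |t| ^ r) volume (-a) a := by
  have h : IntervalIntegrable (fun t : ℝ => |t| ^ r) volume 0 a := by
    refine (intervalIntegral.intervalIntegrable_rpow' (a := 0) (b := a) hr).congr ?_
    intro t ht
    rw [Set.uIoc_of_le ha] at ht
    simp only [abs_of_pos ht.1]
  refine IntervalIntegrable.trans (b := 0) ?_ h
  rw [IntervalIntegrable.iff_comp_neg]
  simpa using h.symm

/-- Rotation reduces to `θ = 0`, where `|e^{it} - 1| = 2 |sin (t/2)| ≥ (2/π) |t|` on `[-π, π]` and
`|t| ^ (-b)` is integrable. -/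
theorem intervalIntegrable_norm_cexp_sub_rpow_neg {b : ℝ} (hb0 : 0 ≤ b) (hb1 : b < 1) (θ : ℝ) :
    IntervalIntegrable
      (fun t : ℝ => ‖Complex.exp (Complex.I * t) - Complex.exp (Complex.I * θ)‖ ^ (-b)) volume
      (-Real.pi) Real.pi := by
  have hpi := Real.pi_pos
  set k : ℝ → ℝ := fun t => ‖Complex.exp (Complex.I * t) - 1‖ ^ (-b) with hk
  have hkm : Measurable k := by fun_prop
  have hkp : Function.Periodic k (2 * Real.pi) := by
    intro t
    simp only [hk]
    congr 3
    rw [Complex.exp_eq_exp_iff_exists_int]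
    exact ⟨1, by push_cast; ring⟩
  have hki : IntervalIntegrable k volume (-Real.pi) Real.pi := by
    refine ((intervalIntegrable_abs_rpow (r := -b) (by linarith) Real.pi hpi.le).const_mul
      ((2 / Real.pi) ^ (-b))).mono_fun' hkm.aestronglyMeasurable ?_
    filter_upwards [ae_restrict_mem measurableSet_uIoc] with t ht
    rw [Set.uIoc_of_le (by linarith)] at ht
    have habs : |t| ≤ Real.pi := abs_le.2 ⟨ht.1.le, ht.2⟩
    simp only [hk]
    rw [Real.norm_of_nonneg (by positivity), ← Real.mul_rpow (by positivity) (abs_nonneg _)]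
    rcases eq_or_ne t 0 with rfl | ht0
    · simp
    · refine Real.rpow_le_rpow_of_nonpos (by positivity) ?_ (by linarith)
      rw [Complex.norm_exp_I_mul_ofReal_sub_one, norm_mul, Real.norm_ofNat, Real.norm_eq_abs]
      have := Real.mul_abs_le_abs_sin (x := t / 2) (by
        rw [abs_div, abs_two]
        linarith)
      rw [abs_div, abs_two] at this
      linarith
  have := (hkp.intervalIntegrable (t := -Real.pi) (by positivity)
    (by rwa [show -Real.pi + 2 * Real.pi = Real.pi by ring]) (-Real.pi - θ)
    (Real.pi - θ)).comp_sub_right θ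
  rw [sub_add_cancel, sub_add_cancel] at this
  convert this using 2 with t
  simp only [hk]
  congr 1
  have e : Complex.exp (Complex.I * t) - Complex.exp (Complex.I * θ) =
      Complex.exp (Complex.I * θ) * (Complex.exp (Complex.I * ((t - θ : ℝ) : ℂ)) - 1) := by
    rw [mul_sub, ← Complex.exp_add, mul_one]
    congr 2
    push_cast
    ring
  rw [e, norm_mul, Complex.norm_exp_I_mul_ofReal, one_mul]

/-- The modulus of the trigonometric polynomial with simple zeros at `±θ`. -/
noncomputable def seasonalModulus (θ t : ℝ) : ℝ :=
  ‖if Real.sin θ = 0 then Complex.exp (Complex.I * t) - Complex.exp (Complex.I * θ)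
    else (Complex.exp (Complex.I * t) - Complex.exp (Complex.I * θ)) *
      (Complex.exp (Complex.I * t) - Complex.exp (-(Complex.I * θ)))‖

theorem seasonalModulus_nonneg (θ t : ℝ) : 0 ≤ seasonalModulus θ t := norm_nonneg _

theorem seasonalModulus_periodic (θ : ℝ) : Function.Periodic (seasonalModulus θ) (2 * Real.pi) := by
  intro t
  have : Complex.exp (Complex.I * ((t + 2 * Real.pi : ℝ) : ℂ)) = Complex.exp (Complex.I * t) := by
    rw [Complex.exp_eq_exp_iff_exists_int]
    exact ⟨1, by push_cast; ring⟩
  simp only [seasonalModulus, this]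

theorem isBddHolder_seasonalModulus (θ : ℝ) : IsBddHolder 1 (seasonalModulus θ) := by
  have h (c : ℂ) : IsBddHolder 1 fun t : ℝ => Complex.exp (Complex.I * t) - c := by
    simpa only [sub_eq_add_neg] using IsBddHolder.cexp.add (IsBddHolder.const 1 (-c))
  unfold seasonalModulus
  by_cases hθ : Real.sin θ = 0
  · simpa only [hθ, if_true] using (h _).norm
  · simpa only [hθ, if_false] using ((h _).mul (h _)).norm

theorem continuous_seasonalModulus (θ : ℝ) : Continuous (seasonalModulus θ) := by
  unfold seasonalModulus
  split_ifs <;> fun_prop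

/-- This turns distinct cosines into disjoint zero sets of the factors. -/
theorem cos_eq_of_seasonalModulus_eq_zero {θ t : ℝ} (h : seasonalModulus θ t = 0) :
    Real.cos t = Real.cos θ := by
  have key : ∀ x : ℝ, Complex.exp (Complex.I * t) = Complex.exp (Complex.I * x) →
      Real.cos t = Real.cos x := by
    intro x hx
    have := congrArg Complex.re hx
    rwa [mul_comm, Complex.exp_ofReal_mul_I_re, mul_comm, Complex.exp_ofReal_mul_I_re] at this
  rw [seasonalModulus, norm_eq_zero] at h
  have h' : Complex.exp (Complex.I * t) = Complex.exp (Complex.I * θ) ∨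
      Complex.exp (Complex.I * t) = Complex.exp (Complex.I * ((-θ : ℝ) : ℂ)) := by
    push_cast
    rw [mul_neg]
    split_ifs at h
    · exact Or.inl (sub_eq_zero.1 h)
    · exact (mul_eq_zero.1 h).imp sub_eq_zero.1 sub_eq_zero.1
  rcases h' with h' | h'
  · exact key _ h'
  · rw [key _ h', Real.cos_neg]

/-- The exponents are real, so the branch of the complex power does not affect the modulus. -/
theorem norm_seasonalFactor_sq (θ d t : ℝ) :
    ‖seasonalFactor θ d (Complex.exp (Complex.I * t))‖ ^ 2 =
      seasonalModulus θ t ^ (-(2 * d)) := by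
  have h1 : ‖seasonalFactor θ d (Complex.exp (Complex.I * t))‖ = seasonalModulus θ t ^ (-d) := by
    unfold seasonalFactor seasonalModulus
    rw [show -(d : ℂ) = ((-d : ℝ) : ℂ) by push_cast; rfl]
    split_ifs
    · rw [Complex.norm_cpow_real]
    · rw [norm_mul, norm_mul, Complex.norm_cpow_real, Complex.norm_cpow_real,
        Real.mul_rpow (norm_nonneg _) (norm_nonneg _)]
  rw [h1, ← Real.rpow_natCast, ← Real.rpow_mul (seasonalModulus_nonneg θ t)]
  congr 1
  push_cast
  ring

/-- If the two zeros are at distance `m > 0`, the larger of the distances `x`, `y` to them is at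
least `m / 2`, whence `(x y)^{-b} ≤ (m/2)^{-b} (x^{-b} + y^{-b})`. -/
theorem intervalIntegrable_seasonalModulus_rpow_neg {b : ℝ} (hb0 : 0 ≤ b) (hb1 : b < 1) (θ : ℝ) :
    IntervalIntegrable (fun t => seasonalModulus θ t ^ (-b)) volume (-Real.pi) Real.pi := by
  by_cases hθ : Real.sin θ = 0
  · simpa only [seasonalModulus, hθ, if_true] using
      intervalIntegrable_norm_cexp_sub_rpow_neg hb0 hb1 θ
  have hneg : Complex.exp (-(Complex.I * θ)) = Complex.exp (Complex.I * ((-θ : ℝ) : ℂ)) := by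
    push_cast
    rw [mul_neg]
  set m : ℝ := ‖Complex.exp (Complex.I * θ) - Complex.exp (Complex.I * ((-θ : ℝ) : ℂ))‖ with hm
  have hm0 : 0 < m := by
    rw [hm, norm_pos_iff]
    intro h
    have := congrArg Complex.im h
    rw [Complex.sub_im, mul_comm, Complex.exp_ofReal_mul_I_im, mul_comm,
      Complex.exp_ofReal_mul_I_im, Real.sin_neg, Complex.zero_im] at this
    exact hθ (by linarith)
  refine (((intervalIntegrable_norm_cexp_sub_rpow_neg hb0 hb1 θ).add
    (intervalIntegrable_norm_cexp_sub_rpow_neg hb0 hb1 (-θ))).const_mul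
      ((m / 2) ^ (-b))).mono_fun' ?_ (ae_of_all _ fun t => ?_)
  · exact ((continuous_seasonalModulus θ).measurable.pow_const _).aestronglyMeasurable
  simp only
  rw [Real.norm_of_nonneg (Real.rpow_nonneg (seasonalModulus_nonneg θ t) _)]
  simp only [seasonalModulus, hθ, if_false, hneg, norm_mul]
  set x := ‖Complex.exp (Complex.I * t) - Complex.exp (Complex.I * θ)‖ with hx
  set y := ‖Complex.exp (Complex.I * t) - Complex.exp (Complex.I * ((-θ : ℝ) : ℂ))‖ with hy
  have hx0 : 0 ≤ x := norm_nonneg _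
  have hy0 : 0 ≤ y := norm_nonneg _
  have hxy : m ≤ x + y := by
    rw [hm, hx, hy, norm_sub_rev (Complex.exp (Complex.I * t)) (Complex.exp (Complex.I * θ))]
    exact norm_sub_le_norm_sub_add_norm_sub _ _ _
  have hxb : 0 ≤ x ^ (-b) := Real.rpow_nonneg hx0 _
  have hyb : 0 ≤ y ^ (-b) := Real.rpow_nonneg hy0 _
  have hmb : 0 ≤ (m / 2) ^ (-b) := by positivity
  rw [Real.mul_rpow hx0 hy0]
  rcases le_total x y with h | h
  · have : y ^ (-b) ≤ (m / 2) ^ (-b) :=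
      Real.rpow_le_rpow_of_nonpos (by positivity) (by linarith) (by linarith)
    nlinarith [mul_le_mul_of_nonneg_left this hxb, mul_nonneg hmb hyb]
  · have : x ^ (-b) ≤ (m / 2) ^ (-b) :=
      Real.rpow_le_rpow_of_nonpos (by positivity) (by linarith) (by linarith)
    nlinarith [mul_le_mul_of_nonneg_left this hyb, mul_nonneg hmb hxb]

theorem IsARMASpectralDensity.periodic {g : ℝ → ℝ} (hg : IsARMASpectralDensity g) :
    Function.Periodic g (2 * Real.pi) := by
  obtain ⟨A, B, s, -, -, -, h⟩ := hg
  intro t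
  have : Complex.exp (Complex.I * ((t + 2 * Real.pi : ℝ) : ℂ)) = Complex.exp (Complex.I * t) := by
    rw [Complex.exp_eq_exp_iff_exists_int]
    exact ⟨1, by push_cast; ring⟩
  simp only [h, this]

theorem IsARMASpectralDensity.isBddHolder {g : ℝ → ℝ} (hg : IsARMASpectralDensity g) :
    IsBddHolder 1 g := by
  obtain ⟨A, B, s, -, -, hA, h⟩ := hg
  obtain ⟨m, hm, hmA⟩ := exists_pos_le_of_periodic (c := 2 * Real.pi)
    (f := fun t : ℝ => ‖Polynomial.aeval (Complex.exp (Complex.I * t)) A‖) (by positivity)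
    ((A.continuous_aeval.comp (by fun_prop)).norm)
    (fun t => by
      have : Complex.exp (Complex.I * ((t + 2 * Real.pi : ℝ) : ℂ)) =
          Complex.exp (Complex.I * t) := by
        rw [Complex.exp_eq_exp_iff_exists_int]
        exact ⟨1, by push_cast; ring⟩
      simp only [this])
    (fun t => norm_pos_iff.2 (hA _ (Complex.norm_exp_I_mul_ofReal t)))
  have hi := ((IsBddHolder.aeval_cexp A).norm).inv hm (fun t => by simpa using hmA t)
  have hB := (IsBddHolder.aeval_cexp B).norm
  have := (IsBddHolder.const 1 (s / (2 * Real.pi))).mul ((hB.mul hB).mul (hi.mul hi))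
  convert this using 2 with t
  rw [h, div_eq_mul_inv (_ ^ 2), sq, sq, mul_inv]

theorem genFractionalDensity_eq {M : ℕ} (Φ : ℝ → ℂ) (θ d : Fin M → ℝ) (t : ℝ) :
    genFractionalDensity Φ θ d t =
      ‖Φ t‖ ^ 2 * ∏ j, seasonalModulus (θ j) t ^ (-(2 * d j)) := by
  rw [genFractionalDensity, norm_prod, ← Finset.prod_pow]
  simp only [norm_seasonalFactor_sq]

theorem genFractionalDensity_periodic {M : ℕ} {Φ : ℝ → ℂ}
    (hΦ : IsARMASpectralDensity fun t => ‖Φ t‖ ^ 2) (θ d : Fin M → ℝ) :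
    Function.Periodic (genFractionalDensity Φ θ d) (2 * Real.pi) := by
  intro t
  have h1 : ‖Φ (t + 2 * Real.pi)‖ ^ 2 = ‖Φ t‖ ^ 2 := hΦ.periodic t
  simp only [genFractionalDensity_eq, h1, fun j => seasonalModulus_periodic (θ j) t]

/-- The weights `W p / N` sum to `1`, and `W p` vanishes at the zeros of every factor but the
`p`-th. The `p`-th piece of the density is therefore `E p ^ (-2 d p)` times a bounded Hölder
function. -/
theorem hasHolderGradient_genFractionalDensity {M : ℕ} [NeZero M] {Φ : ℝ → ℂ}
    (hΦ : IsARMASpectralDensity fun t => ‖Φ t‖ ^ 2) {θ d : Fin M → ℝ}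
    (hθ : ∀ i j, i ≠ j → Real.cos (θ i) ≠ Real.cos (θ j)) (hd : ∀ j, 0 < d j) {β : ℝ}
    (hβ : 0 < β) (hdβ : ∀ j, 2 * d j + β < 1) :
    HasHolderGradient β (genFractionalDensity Φ θ d) := by
  set E : Fin M → ℝ → ℝ := fun j => seasonalModulus (θ j) with hE
  have hE0 : ∀ j t, 0 ≤ E j t := fun j => seasonalModulus_nonneg (θ j)
  have hEH : ∀ j, IsBddHolder 1 (E j) := fun j => isBddHolder_seasonalModulus (θ j)
  have hβ1 : β ≤ 1 := by linarith [hdβ 0, hd 0]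
  set W : Fin M → ℝ → ℝ := fun p t => ∏ q ∈ Finset.univ.erase p, E q t with hW
  have hW0 : ∀ p t, 0 ≤ W p t := fun p t => Finset.prod_nonneg fun q _ => hE0 q t
  set N : ℝ → ℝ := fun t => ∑ p, W p t with hN
  have hNpos : ∀ t, 0 < N t := by
    intro t
    -- At most one factor vanishes at `t`; if none does, any index serves.
    obtain ⟨p, hp⟩ : ∃ p, ∀ q, q ≠ p → E q t ≠ 0 := by
      by_cases h : ∃ p, E p t = 0
      · obtain ⟨p, hp⟩ := h
        refine ⟨p, fun q hq hq0 => hθ q p hq ?_⟩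
        rw [← cos_eq_of_seasonalModulus_eq_zero hp, ← cos_eq_of_seasonalModulus_eq_zero hq0]
      · push Not at h
        exact ⟨0, fun q _ => h q⟩
    refine Finset.sum_pos' (fun p _ => hW0 p t) ⟨p, Finset.mem_univ p, ?_⟩
    exact Finset.prod_pos fun q hq => lt_of_le_of_ne (hE0 q t) (hp q (Finset.ne_of_mem_erase hq)).symm
  obtain ⟨m, hm, hmN⟩ := exists_pos_le_of_periodic (c := 2 * Real.pi) (f := N) (by positivity)
    (continuous_finsetSum _ fun p _ => continuous_finsetProd _ fun q _ =>
      continuous_seasonalModulus (θ q))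
    (fun t => by simp only [hN, hW, hE, fun j => seasonalModulus_periodic (θ j) t]) hNpos
  have hNi : IsBddHolder 1 fun t => (N t)⁻¹ :=
    (IsBddHolder.sum _ fun p _ => IsBddHolder.prod _ fun q _ => hEH q).inv hm
      (fun t => (hmN t).trans (le_abs_self _))
  -- The factor `E q` contained in `W p` lifts the singular exponent `-2 d q` to `1 - 2 d q > β`.
  have hEr : ∀ j, IsBddHolder β fun t => E j t ^ (1 - 2 * d j) := fun j =>
    ((hEH j).rpow (hE0 j) (by linarith [hdβ j]) (by linarith [hd j])).mono hβ.le
      (by linarith [hdβ j])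
  have hH : ∀ p, IsBddHolder β fun t => ‖Φ t‖ ^ 2 * (N t)⁻¹ *
      ∏ q ∈ Finset.univ.erase p, E q t ^ (1 - 2 * d q) := fun p =>
    ((hΦ.isBddHolder.mul hNi).mono hβ.le hβ1).mul (IsBddHolder.prod _ fun q _ => hEr q)
  have hmain := HasHolderGradient.sum (β := β) Finset.univ (fun p (_ : p ∈ Finset.univ) =>
    (hasHolderGradient_rpow_neg (a := 2 * d p) (by linarith [hd p]) hβ (hdβ p).le (hEH p) (hE0 p)
      (seasonalModulus_periodic (θ p)) (intervalIntegrable_seasonalModulus_rpow_neg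
        (by linarith [hd p]) (hdβ p) (θ p))).mul_isBddHolder (hH p))
  convert hmain using 1
  funext t
  have hpow : ∀ q, E q t ^ (1 - 2 * d q) = E q t ^ (-(2 * d q)) * E q t := by
    intro q
    rcases (hE0 q t).eq_or_lt with h | h
    · rw [← h, Real.zero_rpow (by linarith [hdβ q]), mul_zero]
    · rw [sub_eq_neg_add, Real.rpow_add h, Real.rpow_one]
  rw [genFractionalDensity_eq]
  have hterm : ∀ p, E p t ^ (-(2 * d p)) * (‖Φ t‖ ^ 2 * (N t)⁻¹ *
      ∏ q ∈ Finset.univ.erase p, E q t ^ (1 - 2 * d q)) =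
      ‖Φ t‖ ^ 2 * (∏ q, E q t ^ (-(2 * d q))) * (N t)⁻¹ * W p t := by
    intro p
    simp only [hpow, Finset.prod_mul_distrib]
    rw [← Finset.mul_prod_erase Finset.univ (fun q => E q t ^ (-(2 * d q))) (Finset.mem_univ p)]
    ring
  simp only [hterm]
  rw [← Finset.mul_sum, mul_assoc, inv_mul_cancel₀ (hNpos t).ne', mul_one]

/-- Decay of the covariances of a generalised fractional process. -/
theorem exists_abs_autocov_le {Ω : Type*} [MeasurableSpace Ω] {P : Measure Ω} {X : ℕ → Ω → ℝ}
    {M : ℕ} [NeZero M] {Φ : ℝ → ℂ}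
    (hΦ : IsARMASpectralDensity fun t => ‖Φ t‖ ^ 2) {θ d : Fin M → ℝ}
    (hθ : ∀ i j, i ≠ j → Real.cos (θ i) ≠ Real.cos (θ j)) (hd : ∀ j, 0 < d j)
    (hf : HasSpectralDensity X P (genFractionalDensity Φ θ d)) {β : ℝ}
    (hβ : 0 < β) (hdβ : ∀ j, 2 * d j + β < 1) :
    ∃ C : ℝ, 0 ≤ C ∧ ∀ h : ℕ, 1 ≤ h → |autocov X P h| ≤ C * (h : ℝ) ^ (-β) := by
  obtain ⟨C, hC, h⟩ := (hasHolderGradient_genFractionalDensity hΦ hθ hd hβ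
    hdβ).exists_norm_fourier_le (genFractionalDensity_periodic hΦ θ d) hf.integrable
  refine ⟨C, hC, fun k hk => ?_⟩
  have := h k hk
  rwa [← hf.autocov_eq, Complex.norm_real, Real.norm_eq_abs] at this

/-! ### The sampled process -/

theorem randomWalk_add {Ω : Type*} (Δ : ℕ → Ω → ℕ) (n h : ℕ) (ω : Ω) :
    randomWalk Δ (n + h) ω = randomWalk Δ n ω + ∑ j ∈ Finset.range h, Δ (n + j) ω :=
  Finset.sum_range_add _ _ _

variable {Ω : Type*} [MeasurableSpace Ω]

/-- Integration of a function of two independent variables, one of them discrete. -/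
theorem integrable_and_integral_eq_of_indepFun {P : Measure Ω} [IsProbabilityMeasure P]
    {E ι : Type*} [MeasurableSpace E] [Countable ι] [MeasurableSpace ι]
    [MeasurableSingletonClass ι] {U : Ω → E} {Z : Ω → ι} (hU : Measurable U) (hZ : Measurable Z)
    (hUZ : IndepFun U Z P) {G : ι → E → ℝ} (hG : ∀ i, Measurable (G i))
    (hGi : ∀ i, Integrable (fun ω => G i (U ω)) P) {B : ℝ}
    (hB : ∀ i, ∫ ω, |G i (U ω)| ∂P ≤ B) :
    Integrable (fun ω => G (Z ω) (U ω)) P ∧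
      ∫ ω, G (Z ω) (U ω) ∂P = ∫ ω, (∫ ω', G (Z ω) (U ω') ∂P) ∂P := by
  set F : E × ι → ℝ := fun p => G p.2 p.1 with hF
  have hFm : Measurable F := measurable_from_prod_countable_left hG
  have hmap : P.map (fun ω => (U ω, Z ω)) = (P.map U).prod (P.map Z) :=
    (indepFun_iff_map_prod_eq_prod_map_map hU.aemeasurable hZ.aemeasurable).1 hUZ
  have hUp : IsProbabilityMeasure (P.map U) := Measure.isProbabilityMeasure_map hU.aemeasurable
  have hZp : IsProbabilityMeasure (P.map Z) := Measure.isProbabilityMeasure_map hZ.aemeasurable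
  have hFi : Integrable F ((P.map U).prod (P.map Z)) := by
    rw [integrable_prod_iff' hFm.aestronglyMeasurable]
    refine ⟨ae_of_all _ fun i => ?_, ?_⟩
    · exact (integrable_map_measure (hG i).aestronglyMeasurable hU.aemeasurable).2 (hGi i)
    -- The bound `B` is uniform in the discrete variable, whose law is finite; this is what Fubini
    -- needs.
    · refine Integrable.of_bound (measurable_of_countable _).aestronglyMeasurable B
        (ae_of_all _ fun i => ?_)
      rw [Real.norm_of_nonneg (integral_nonneg fun _ => norm_nonneg _),
        integral_map hU.aemeasurable (hG i).norm.aestronglyMeasurable]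
      exact hB i
  refine ⟨?_, ?_⟩
  · rw [← hmap] at hFi
    exact (integrable_map_measure hFm.aestronglyMeasurable (hU.prodMk hZ).aemeasurable).1 hFi
  · calc ∫ ω, G (Z ω) (U ω) ∂P = ∫ p, F p ∂(P.map fun ω => (U ω, Z ω)) :=
          (integral_map (hU.prodMk hZ).aemeasurable hFm.aestronglyMeasurable).symm
      _ = ∫ i, (∫ x, F (x, i) ∂(P.map U)) ∂(P.map Z) := by
          rw [hmap, integral_prod_symm _ hFi]
      _ = ∫ ω, (∫ x, F (x, Z ω) ∂(P.map U)) ∂P :=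
          integral_map hZ.aemeasurable (measurable_of_countable _).aestronglyMeasurable
      _ = _ := by
          congr 1
          funext ω
          exact integral_map hU.aemeasurable (hG _).aestronglyMeasurable

namespace IsSecondOrderStationary

variable {P : Measure Ω} [IsProbabilityMeasure P] {X : ℕ → Ω → ℝ}

theorem integral_mul (hX : IsSecondOrderStationary X P) (n h : ℕ) :
    ∫ ω, X n ω * X (n + h) ω ∂P = autocov X P h + (∫ ω, X 0 ω ∂P) ^ 2 := by
  have := covariance_eq_sub (hX.memLp n) (hX.memLp (n + h))
  rw [hX.cov_eq, hX.mean_eq n, hX.mean_eq (n + h)] at this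
  simp only [Pi.mul_apply] at this
  rw [autocov, this]
  ring

theorem integral_sq (hX : IsSecondOrderStationary X P) (n : ℕ) :
    ∫ ω, X n ω ^ 2 ∂P = autocov X P 0 + (∫ ω, X 0 ω ∂P) ^ 2 := by
  rw [← hX.integral_mul n 0]
  simp only [add_zero, sq]

theorem integral_abs_mul_le (hX : IsSecondOrderStationary X P) (n m : ℕ) :
    ∫ ω, |X n ω * X m ω| ∂P ≤ autocov X P 0 + (∫ ω, X 0 ω ∂P) ^ 2 := by
  have hn := (hX.memLp n).integrable_sq
  have hm := (hX.memLp m).integrable_sq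
  calc ∫ ω, |X n ω * X m ω| ∂P ≤ ∫ ω, (X n ω ^ 2 + X m ω ^ 2) / 2 ∂P := by
        refine integral_mono_of_nonneg (ae_of_all _ fun _ => abs_nonneg _)
          ((hn.add hm).div_const 2) (ae_of_all _ fun ω => ?_)
        simp only [abs_mul]
        nlinarith [sq_nonneg (|X n ω| - |X m ω|), sq_abs (X n ω), sq_abs (X m ω)]
    _ = _ := by
        rw [integral_div, integral_add hn hm, hX.integral_sq, hX.integral_sq]
        ring

/-- A crude bound, obtained by removing the squared mean from the product moment; only boundedness
matters later. -/
theorem abs_autocov_le (hX : IsSecondOrderStationary X P) (h : ℕ) :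
    |autocov X P h| ≤ autocov X P 0 + 2 * (∫ ω, X 0 ω ∂P) ^ 2 := by
  have h1 := hX.integral_mul 0 h
  have h2 := hX.integral_abs_mul_le 0 (0 + h)
  have h3 : |∫ ω, X 0 ω * X (0 + h) ω ∂P| ≤ _ := abs_integral_le_integral_abs
  rw [h1] at h3
  have h4 := abs_le.1 (h3.trans h2)
  exact abs_le.2 ⟨by linarith [h4.1], by nlinarith [h4.2, sq_nonneg (∫ ω, X 0 ω ∂P)]⟩

end IsSecondOrderStationary

namespace IsSamplingSteps

variable {P : Measure Ω} {Δ : ℕ → Ω → ℕ} {S : PMF ℕ}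

theorem measurable_randomWalk (hΔ : IsSamplingSteps Δ S P) (n : ℕ) :
    Measurable (randomWalk Δ n) :=
  Finset.measurable_fun_sum _ fun j _ => hΔ.measurable j

theorem map_shift (hΔ : IsSamplingSteps Δ S P) (n : ℕ) :
    P.map (fun ω j => Δ (n + j) ω) = Measure.infinitePi fun _ : ℕ => S.toMeasure := by
  have h := hΔ.indep.precomp (add_right_injective n)
  rw [iIndepFun.map_fun_eq_infinitePi_map (X := fun j => Δ (n + j))
    (fun j => hΔ.measurable (n + j)) h]
  simp only [hΔ.law]

/-- The increments of the random walk are stationary. -/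
theorem integral_increment (hΔ : IsSamplingSteps Δ S P) (n h : ℕ) (r : ℕ → ℝ) :
    ∫ ω, r (∑ j ∈ Finset.range h, Δ (n + j) ω) ∂P = ∫ ω, r (randomWalk Δ h ω) ∂P := by
  have hr : Measurable fun x : ℕ → ℕ => r (∑ j ∈ Finset.range h, x j) :=
    (measurable_of_countable r).comp (Finset.measurable_fun_sum _ fun j _ => measurable_pi_apply j)
  have key : ∀ n, ∫ ω, r (∑ j ∈ Finset.range h, Δ (n + j) ω) ∂P =
      ∫ x, r (∑ j ∈ Finset.range h, x j) ∂(Measure.infinitePi fun _ : ℕ => S.toMeasure) := by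
    intro n
    rw [← hΔ.map_shift n, integral_map
      (measurable_pi_lambda _ fun j => hΔ.measurable (n + j)).aemeasurable
      hr.aestronglyMeasurable]
  rw [key n, ← key 0]
  simp only [zero_add, randomWalk]

end IsSamplingSteps

section SampledProcess

variable {P : Measure Ω} {X : ℕ → Ω → ℝ} {Δ : ℕ → Ω → ℕ} {S : PMF ℕ}

theorem measurable_sampledProcess (hX : IsSecondOrderStationary X P)
    (hΔ : IsSamplingSteps Δ S P) (n : ℕ) : Measurable (sampledProcess X (randomWalk Δ) n) := by
  have h : Measurable fun p : Ω × ℕ => X p.2 p.1 :=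
    measurable_from_prod_countable_left hX.measurable
  exact h.comp (measurable_id.prodMk (hΔ.measurable_randomWalk n))

variable [IsProbabilityMeasure P]

/-- Freezes the pair of sampling times: the whole path of `X` is independent of `(T_n, T_m)`, which
takes countably many values. -/
theorem integral_sampledProcess_comp (hX : IsSecondOrderStationary X P)
    (hΔ : IsSamplingSteps Δ S P)
    (hindep : IndepFun (fun ω n => X n ω) (fun ω n => randomWalk Δ n ω) P) (n m : ℕ)
    {G : ℝ → ℝ → ℝ} (hG : Measurable (Function.uncurry G))
    (hGi : ∀ i j, Integrable (fun ω => G (X i ω) (X j ω)) P) {B : ℝ}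
    (hB : ∀ i j, ∫ ω, |G (X i ω) (X j ω)| ∂P ≤ B) :
    Integrable (fun ω => G (sampledProcess X (randomWalk Δ) n ω)
        (sampledProcess X (randomWalk Δ) m ω)) P ∧
      ∫ ω, G (sampledProcess X (randomWalk Δ) n ω) (sampledProcess X (randomWalk Δ) m ω) ∂P =
        ∫ ω, (∫ ω', G (X (randomWalk Δ n ω) ω') (X (randomWalk Δ m ω) ω') ∂P) ∂P := by
  have hZ := hindep.comp (φ := id) (ψ := fun x : ℕ → ℕ => (x n, x m)) measurable_id (by fun_prop)
  exact integrable_and_integral_eq_of_indepFun (U := fun ω n => X n ω)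
    (Z := fun ω => (randomWalk Δ n ω, randomWalk Δ m ω))
    (G := fun p x => G (x p.1) (x p.2)) (measurable_pi_lambda _ hX.measurable)
    ((hΔ.measurable_randomWalk n).prodMk (hΔ.measurable_randomWalk m)) hZ
    (fun p => hG.comp (g := Function.uncurry G) (f := fun x : ℕ → ℝ => (x p.1, x p.2))
      (by fun_prop))
    (fun p => hGi p.1 p.2) (fun p => hB p.1 p.2)

theorem memLp_sampledProcess (hX : IsSecondOrderStationary X P) (hΔ : IsSamplingSteps Δ S P)
    (hindep : IndepFun (fun ω n => X n ω) (fun ω n => randomWalk Δ n ω) P) (n : ℕ) :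
    MemLp (sampledProcess X (randomWalk Δ) n) 2 P := by
  rw [memLp_two_iff_integrable_sq (measurable_sampledProcess hX hΔ n).aestronglyMeasurable]
  have := (integral_sampledProcess_comp hX hΔ hindep n n (G := fun x y => x * y) (by fun_prop)
    (fun i j => (hX.memLp i).integrable_mul (hX.memLp j))
    (fun i j => hX.integral_abs_mul_le i j)).1
  simpa only [sq] using this

theorem integral_sampledProcess (hX : IsSecondOrderStationary X P) (hΔ : IsSamplingSteps Δ S P)
    (hindep : IndepFun (fun ω n => X n ω) (fun ω n => randomWalk Δ n ω) P) (n : ℕ) :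
    ∫ ω, sampledProcess X (randomWalk Δ) n ω ∂P = ∫ ω, X 0 ω ∂P := by
  have hi : ∀ i, Integrable (X i) P := fun i => (hX.memLp i).integrable one_le_two
  have := (integral_sampledProcess_comp hX hΔ hindep n n (G := fun x _ => x) (by fun_prop)
    -- This `B` comes from `|x| ≤ x ^ 2 + 1`.
    (fun i _ => hi i) (B := autocov X P 0 + (∫ ω, X 0 ω ∂P) ^ 2 + 1) (fun i _ => ?_)).2
  · rw [this]
    simp only [hX.mean_eq, integral_const, probReal_univ, one_smul]
  · rw [← hX.integral_sq i]
    calc ∫ ω, |X i ω| ∂P ≤ ∫ ω, (X i ω ^ 2 + 1) ∂P := by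
          refine integral_mono (hi i).abs ((hX.memLp i).integrable_sq.add (integrable_const 1))
            fun ω => ?_
          simp only
          nlinarith [sq_nonneg (|X i ω| - 1), sq_abs (X i ω), abs_nonneg (X i ω)]
      _ = _ := by
          rw [integral_add (hX.memLp i).integrable_sq (integrable_const 1)]
          simp

/-- Given the walk, the product moment is `σ_X(T_{n+h} - T_n)` plus the squared mean. The increment
has the law of `T_h`, and the squared mean cancels because `Y` has the mean of `X`. -/
theorem covariance_sampledProcess (hX : IsSecondOrderStationary X P) (hΔ : IsSamplingSteps Δ S P)
    (hindep : IndepFun (fun ω n => X n ω) (fun ω n => randomWalk Δ n ω) P) (n h : ℕ) :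
    covariance (sampledProcess X (randomWalk Δ) n) (sampledProcess X (randomWalk Δ) (n + h)) P =
      ∫ ω, autocov X P (randomWalk Δ h ω) ∂P := by
  have hprod := (integral_sampledProcess_comp hX hΔ hindep n (n + h) (G := fun x y => x * y)
    (by fun_prop) (fun i j => (hX.memLp i).integrable_mul (hX.memLp j))
    (fun i j => hX.integral_abs_mul_le i j)).2
  simp only [randomWalk_add, hX.integral_mul] at hprod
  have hσ : Integrable (fun ω => autocov X P (randomWalk Δ h ω)) P :=
    Integrable.of_bound ((measurable_of_countable (autocov X P)).comp
      (hΔ.measurable_randomWalk h)).aestronglyMeasurable _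
      (ae_of_all _ fun ω => hX.abs_autocov_le _)
  rw [hΔ.integral_increment n h fun k => autocov X P k + (∫ ω, X 0 ω ∂P) ^ 2,
    integral_add hσ (integrable_const _)] at hprod
  rw [covariance_eq_sub (memLp_sampledProcess hX hΔ hindep n)
    (memLp_sampledProcess hX hΔ hindep (n + h)), integral_sampledProcess hX hΔ hindep,
    integral_sampledProcess hX hΔ hindep]
  simp only [Pi.mul_apply]
  rw [hprod, integral_const, probReal_univ, one_smul]
  ring

theorem isSecondOrderStationary_sampledProcess (hX : IsSecondOrderStationary X P)
    (hΔ : IsSamplingSteps Δ S P)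
    (hindep : IndepFun (fun ω n => X n ω) (fun ω n => randomWalk Δ n ω) P) :
    IsSecondOrderStationary (sampledProcess X (randomWalk Δ)) P where
  measurable := measurable_sampledProcess hX hΔ
  memLp := memLp_sampledProcess hX hΔ hindep
  mean_eq n := by rw [integral_sampledProcess hX hΔ hindep, integral_sampledProcess hX hΔ hindep]
  cov_eq n h := by
    have h0 := covariance_sampledProcess hX hΔ hindep 0 h
    rw [zero_add] at h0
    rw [h0, covariance_sampledProcess hX hΔ hindep n h]

theorem autocov_sampledProcess (hX : IsSecondOrderStationary X P) (hΔ : IsSamplingSteps Δ S P)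
    (hindep : IndepFun (fun ω n => X n ω) (fun ω n => randomWalk Δ n ω) P) (h : ℕ) :
    autocov (sampledProcess X (randomWalk Δ)) P h =
      ∫ ω, autocov X P (randomWalk Δ h ω) ∂P := by
  have h0 := covariance_sampledProcess hX hΔ hindep 0 h
  rwa [zero_add] at h0

end SampledProcess

/-! ### Lower deviations of the random walk -/

/-- The block `(n, 2n]` suffices: it has `n` points, each of mass at least `(c/2) (2n)^{-γ}` for
large `n`. -/
theorem exists_mul_rpow_le_tail {S : PMF ℕ} {c γ : ℝ} (hc : 0 < c) (hγ : 1 < γ)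
    (hS : (fun j : ℕ => (S j).toReal) ~[atTop] fun j : ℕ => c * (j : ℝ) ^ (-γ)) :
    ∃ a : ℝ, 0 < a ∧ ∃ N : ℕ, ∀ n, N ≤ n →
      a * (n : ℝ) ^ (1 - γ) ≤ S.toMeasure.real (Set.Ioi n) := by
  obtain ⟨φ, hφ, hSφ⟩ := hS.exists_eq_mul
  have hev : ∀ᶠ j : ℕ in atTop, c / 2 * (j : ℝ) ^ (-γ) ≤ (S j).toReal := by
    filter_upwards [hSφ, hφ.eventually (lt_mem_nhds (show (1 / 2 : ℝ) < 1 by norm_num))]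
      with j hj hφj
    rw [hj, Pi.mul_apply]
    have : 0 ≤ c * (j : ℝ) ^ (-γ) := by positivity
    nlinarith
  obtain ⟨N, hN⟩ := eventually_atTop.1 hev
  refine ⟨c / 2 * 2 ^ (-γ), by positivity, max N 1, fun n hn => ?_⟩
  have hn1 : 1 ≤ n := (le_max_right _ _).trans hn
  have hnN : N ≤ n := (le_max_left _ _).trans hn
  have hn0 : (0 : ℝ) < n := by exact_mod_cast hn1
  calc c / 2 * 2 ^ (-γ) * (n : ℝ) ^ (1 - γ)
      = ∑ j ∈ Finset.Ioc n (2 * n), c / 2 * (2 * (n : ℝ)) ^ (-γ) := by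
        rw [Finset.sum_const, Nat.card_Ioc, show 2 * n - n = n by omega, nsmul_eq_mul,
          Real.mul_rpow zero_le_two hn0.le, sub_eq_add_neg, Real.rpow_add hn0, Real.rpow_one]
        ring
    _ ≤ ∑ j ∈ Finset.Ioc n (2 * n), (S j).toReal := by
        refine Finset.sum_le_sum fun j hj => ?_
        rw [Finset.mem_Ioc] at hj
        refine le_trans ?_ (hN j (hnN.trans hj.1.le))
        have hj0 : (0 : ℝ) < j := by exact_mod_cast (hn1.trans hj.1.le)
        have hj2 : (j : ℝ) ≤ 2 * n := by exact_mod_cast hj.2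
        exact mul_le_mul_of_nonneg_left
          (Real.rpow_le_rpow_of_nonpos hj0 hj2 (by linarith)) (by positivity)
    _ = S.toMeasure.real (Finset.Ioc n (2 * n) : Finset ℕ) := by
        rw [measureReal_def, S.toMeasure_apply_finset,
          ENNReal.toReal_sum fun j _ => S.apply_ne_top j]
    _ ≤ S.toMeasure.real (Set.Ioi n) := by
        refine measureReal_mono fun j hj => ?_
        exact (Finset.mem_Ioc.1 (Finset.mem_coe.1 hj)).1

/-- The steps are nonnegative, so each is bounded by their sum; independence and `1 - x ≤ e^{-x}` do
the rest. -/
theorem IsSamplingSteps.measureReal_randomWalk_le {P : Measure Ω}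
    [IsProbabilityMeasure P] {Δ : ℕ → Ω → ℕ} {S : PMF ℕ} (hΔ : IsSamplingSteps Δ S P) (h n : ℕ) :
    P.real {ω | randomWalk Δ h ω ≤ n} ≤ Real.exp (-(h * S.toMeasure.real (Set.Ioi n))) := by
  have hsub : {ω | randomWalk Δ h ω ≤ n} ⊆ ⋂ j ∈ Finset.range h, Δ j ⁻¹' Set.Iic n := by
    intro ω hω
    simp only [Set.mem_iInter]
    intro j hj
    exact (Finset.single_le_sum (f := fun j => Δ j ω) (fun _ _ => Nat.zero_le _) hj).trans hω
  have hlaw : ∀ j, P (Δ j ⁻¹' Set.Iic n) = S.toMeasure (Set.Iic n) := fun j => by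
    rw [← hΔ.law j, Measure.map_apply (hΔ.measurable j) measurableSet_Iic]
  have hcompl : S.toMeasure.real (Set.Iic n) = 1 - S.toMeasure.real (Set.Ioi n) := by
    rw [← Set.compl_Ioi, probReal_compl_eq_one_sub measurableSet_Ioi]
  calc P.real {ω | randomWalk Δ h ω ≤ n}
      ≤ P.real (⋂ j ∈ Finset.range h, Δ j ⁻¹' Set.Iic n) := measureReal_mono hsub
    _ = (1 - S.toMeasure.real (Set.Ioi n)) ^ h := by
        rw [measureReal_def, hΔ.indep.measure_inter_preimage_eq_mul
          (Finset.range h) (fun _ _ => measurableSet_Iic)]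
        simp only [hlaw, Finset.prod_const, Finset.card_range, ENNReal.toReal_pow]
        rw [← measureReal_def, hcompl]
    _ ≤ Real.exp (-S.toMeasure.real (Set.Ioi n)) ^ h := by
        refine pow_le_pow_left₀ ?_ (Real.one_sub_le_exp_neg _) h
        rw [← hcompl]
        exact measureReal_nonneg
    _ = _ := by
        rw [← Real.exp_nat_mul]
        congr 1
        ring

theorem summable_exp_neg_mul_rpow {b ε : ℝ} (hb : 0 < b) (hε : 0 < ε) :
    Summable fun h : ℕ => Real.exp (-b * (h : ℝ) ^ ε) := by
  -- The exponent `-2 / ε` becomes `-2` after substituting `h ^ ε`.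
  have h1 := (isLittleO_exp_neg_mul_rpow_atTop hb (-2 / ε)).comp_tendsto
    ((tendsto_rpow_atTop hε).comp (tendsto_natCast_atTop_atTop (R := ℝ)))
  refine summable_of_isBigO_nat (Real.summable_nat_rpow.2 (show (-2 : ℝ) < -1 by norm_num))
    (h1.isBigO.congr_right fun h => ?_)
  simp only [Function.comp_apply]
  rw [← Real.rpow_mul (Nat.cast_nonneg h)]
  congr 1
  field_simp

/-- Summability of the mean of a decaying sequence along a heavy-tailed random walk. -/
theorem summable_abs_integral_randomWalk {P : Measure Ω}
    [IsProbabilityMeasure P] {Δ : ℕ → Ω → ℕ} {S : PMF ℕ} (hΔ : IsSamplingSteps Δ S P) {c γ : ℝ}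
    (hc : 0 < c) (hγ : 1 < γ)
    (hS : (fun j : ℕ => (S j).toReal) ~[atTop] fun j : ℕ => c * (j : ℝ) ^ (-γ))
    {σ : ℕ → ℝ} {B C β : ℝ} (hB : ∀ k, |σ k| ≤ B) (hC : 0 ≤ C)
    (hσ : ∀ k : ℕ, 1 ≤ k → |σ k| ≤ C * (k : ℝ) ^ (-β)) (hβ : γ - 1 < β) :
    Summable fun h => |∫ ω, σ (randomWalk Δ h ω) ∂P| := by
  have hκ : 0 < γ - 1 := by linarith
  have hβ0 : 0 < β := hκ.trans hβ
  have hB0 : 0 ≤ B := (abs_nonneg _).trans (hB 0)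
  -- `ρ > 1/β` makes `h^{-ρβ}` summable; `ρ < 1/(γ-1)` keeps the exponent `1 - ρ(γ-1)` positive.
  obtain ⟨ρ, hρ1, hρ2⟩ := exists_between (one_div_lt_one_div_of_lt hκ hβ)
  have hρ0 : 0 < ρ := (by positivity : 0 < 1 / β).trans hρ1
  rw [div_lt_iff₀ hβ0] at hρ1
  rw [lt_div_iff₀ hκ] at hρ2
  obtain ⟨a, ha, N, hN⟩ := exists_mul_rpow_le_tail hc hγ hS
  set b : ℝ := a * 2 ^ (1 - γ) with hb
  have hb0 : 0 < b := by positivity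
  have hsplit : ∀ h n : ℕ, 1 ≤ n → |∫ ω, σ (randomWalk Δ h ω) ∂P| ≤
      B * P.real {ω | randomWalk Δ h ω ≤ n} + C * (n : ℝ) ^ (-β) := by
    intro h n hn
    have hn0 : (0 : ℝ) < n := by exact_mod_cast hn
    have hm : MeasurableSet {ω | randomWalk Δ h ω ≤ n} :=
      measurableSet_le (hΔ.measurable_randomWalk h) measurable_const
    have hi : Integrable ({ω | randomWalk Δ h ω ≤ n}.indicator fun _ => B) P :=
      (integrable_const B).indicator hm
    calc |∫ ω, σ (randomWalk Δ h ω) ∂P|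
        ≤ ∫ ω, ({ω | randomWalk Δ h ω ≤ n}.indicator (fun _ => B) ω + C * (n : ℝ) ^ (-β)) ∂P := by
          rw [← Real.norm_eq_abs]
          refine norm_integral_le_of_norm_le (hi.add (integrable_const _))
            (ae_of_all _ fun ω => ?_)
          by_cases hω : randomWalk Δ h ω ≤ n
          · rw [Set.indicator_of_mem (by exact hω)]
            exact (hB _).trans (le_add_of_nonneg_right (by positivity))
          · rw [Set.indicator_of_notMem (by exact hω), zero_add]
            push Not at hω
            refine (hσ _ (hn.trans hω.le)).trans (mul_le_mul_of_nonneg_left ?_ hC)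
            exact Real.rpow_le_rpow_of_nonpos hn0 (by exact_mod_cast hω.le) (by linarith)
      _ = _ := by
          rw [integral_add hi (integrable_const _), integral_indicator_const _ hm]
          simp [mul_comm]
  refine Summable.of_norm_bounded_eventually_nat
    (g := fun h : ℕ => B * Real.exp (-b * (h : ℝ) ^ (1 - ρ * (γ - 1))) +
      C * (h : ℝ) ^ (-(ρ * β))) ?_ ?_
  · exact ((summable_exp_neg_mul_rpow hb0 (by linarith)).mul_left B).add
      ((Real.summable_nat_rpow.2 (by linarith)).mul_left C)
  have hlarge : ∀ᶠ h : ℕ in atTop, (N : ℝ) ≤ (h : ℝ) ^ ρ :=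
    ((tendsto_rpow_atTop hρ0).comp (tendsto_natCast_atTop_atTop (R := ℝ))).eventually_ge_atTop _
  filter_upwards [hlarge, eventually_ge_atTop 1] with h hhN hh1
  have hh : (1 : ℝ) ≤ h := by exact_mod_cast hh1
  have hh0 : (0 : ℝ) < h := by linarith
  have hhρ : 1 ≤ (h : ℝ) ^ ρ := Real.one_le_rpow hh hρ0.le
  -- Of the bounds `h^ρ ≤ n ≤ 2 h^ρ`, the upper one controls the tail `n^{1-γ}` from below and the
  -- lower one controls `n^{-β}` from above.
  set n : ℕ := ⌈(h : ℝ) ^ ρ⌉₊ with hn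
  have hn1 : (h : ℝ) ^ ρ ≤ n := Nat.le_ceil _
  have hn2 : (n : ℝ) ≤ 2 * (h : ℝ) ^ ρ := by
    have := Nat.ceil_lt_add_one (show 0 ≤ (h : ℝ) ^ ρ by linarith)
    linarith
  have hn3 : 1 ≤ n := by exact_mod_cast hhρ.trans hn1
  have hn0 : (0 : ℝ) < n := by linarith
  rw [Real.norm_of_nonneg (abs_nonneg _)]
  refine (hsplit h n hn3).trans (add_le_add (mul_le_mul_of_nonneg_left ?_ hB0)
    (mul_le_mul_of_nonneg_left ?_ hC))
  · refine (hΔ.measureReal_randomWalk_le h n).trans (Real.exp_le_exp.2 ?_)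
    have htail := hN n (by exact_mod_cast hhN.trans hn1)
    have hpow : (2 * (h : ℝ) ^ ρ) ^ (1 - γ) ≤ (n : ℝ) ^ (1 - γ) :=
      Real.rpow_le_rpow_of_nonpos hn0 hn2 (by linarith)
    rw [Real.mul_rpow zero_le_two (by positivity), ← Real.rpow_mul hh0.le] at hpow
    rw [neg_mul, neg_le_neg_iff]
    calc b * (h : ℝ) ^ (1 - ρ * (γ - 1))
        = h * (a * (2 ^ (1 - γ) * (h : ℝ) ^ (ρ * (1 - γ)))) := by
          rw [show 1 - ρ * (γ - 1) = 1 + ρ * (1 - γ) by ring, Real.rpow_add hh0, Real.rpow_one, hb]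
          ring
      _ ≤ h * (a * (n : ℝ) ^ (1 - γ)) := by gcongr
      _ ≤ h * S.toMeasure.real (Set.Ioi n) := by gcongr
  · rw [← mul_neg, Real.rpow_mul hh0.le]
    exact Real.rpow_le_rpow_of_nonpos (by linarith) hn1 (by linarith)

end RandomSampling

theorem mainTheorem10 {Ω : Type*} [MeasurableSpace Ω] (P : Measure Ω) [IsProbabilityMeasure P]
    (X : ℕ → Ω → ℝ) (hX : RandomSampling.IsSecondOrderStationary X P)
    {M : ℕ} (Φ : ℝ → ℂ) (hΦ : RandomSampling.IsARMASpectralDensity fun t => ‖Φ t‖ ^ 2)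
    (θ d : Fin M → ℝ) (hθ : ∀ i j, i ≠ j → Real.cos (θ i) ≠ Real.cos (θ j))
    (hd : ∀ j, d j ∈ Set.Ioo (0 : ℝ) (1 / 2))
    (hf : RandomSampling.HasSpectralDensity X P (RandomSampling.genFractionalDensity Φ θ d))
    (dmax : ℝ) (hdmax : IsGreatest (Set.range d) dmax)
    (Δ : ℕ → Ω → ℕ) (S : PMF ℕ) (hΔ : RandomSampling.IsSamplingSteps Δ S P)
    (hindep : IndepFun (fun ω n => X n ω) (fun ω n => RandomSampling.randomWalk Δ n ω) P)
    (c γ : ℝ) (hc : 0 < c)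
    (hS : (fun j : ℕ => (S j).toReal) ~[atTop] fun j : ℕ => c * (j : ℝ) ^ (-γ))
    (hγ : 1 < γ) (hγd : γ < 2 * (1 - dmax)) :
    RandomSampling.HasShortMemory
      (RandomSampling.sampledProcess X (RandomSampling.randomWalk Δ)) P := by
  refine ⟨RandomSampling.isSecondOrderStationary_sampledProcess hX hΔ hindep, ?_⟩
  obtain ⟨i, -⟩ := hdmax.1
  have hM : NeZero M := ⟨i.pos.ne'⟩
  -- The assumption `γ < 2(1 - d)` says exactly that this interval is nonempty; `γ > 1` makes `β`
  -- positive.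
  obtain ⟨β, hβ1, hβ2⟩ := exists_between (show γ - 1 < 1 - 2 * dmax by linarith)
  obtain ⟨C, hC, hσ⟩ := RandomSampling.exists_abs_autocov_le hΦ hθ (fun j => (hd j).1) hf
    (show 0 < β by linarith) fun j => by linarith [hdmax.2 (Set.mem_range_self j)]
  simp only [RandomSampling.autocov_sampledProcess hX hΔ hindep]
  exact RandomSampling.summable_abs_integral_randomWalk hΔ hc hγ hS hX.abs_autocov_le hC hσ hβ1
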